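/- Let $\mathcal{A}$ be a set of actions. For a poset $X$ let $\mathcal{S}X$ be the poset of finitely supported subdistributions on $X$, i.e. maps $\mu\colon X\to[0,1]$ with finite support and $\sum_x\mu(x)\le 1$, written as formal sums $\sum_{i=1}^n p_i\cdot x_i$ with $p_i\in(0,1]$. A formal sum $\sum_{i=1}^n p_i\cdot x_i$ is obviously below $\sum_{j=1}^m q_j\cdot y_j$ if there is an injection $f\colon\{1,\dots,n\}\to\{1,\dots,m\}$ with $p_i\le q_{f(i)}$ and $x_i\le y_{f(i)}$ for all $i$; a subdivision of a formal sum is obtained by splitting each summand $p_i\cdot x_i$ into summands $p_{i1}\cdot x_i,\dots,p_{im_i}\cdot x_i$ with $\sum_j p_{ij}=p_i$; and $\mu\le\nu$ in $\mathcal{S}X$ iff $\mu$ and $\nu$ have subdivisions $d_1$, $d_2$ such that $d_1$ is obviously below $d_2$. Let $M_nX=\mathcal{S}(\mathcal{A}^n\times X)$, where $\mathcal{A}^n$ is discretely ordered. This is a graded monad on posets, with unit $\eta\colon X\to M_0X$, $x\mapsto 1\cdot(\varepsilon,x)$, and multiplication $\mu^{n,k}\colon M_nM_kX\to M_{n+k}X$,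 $\sum_i p_i\cdot\bigl(v_i,\sum_j q_{ij}\cdot(w_{ij},x_{ij})\bigr)\mapsto\sum_{i,j}p_iq_{ij}\cdot(v_iw_{ij},x_{ij})$. An $M_0$-algebra is an Eilenberg–Moore algebra for the monad $M_0$. An $M_1$-algebra $A$ consists of $M_0$-algebras $(A_0,a^{00})$, $(A_1,a^{01})$ and a monotone map $a^{10}\colon M_1A_0\to A_1$ with $a^{01}\cdot M_0a^{10}=a^{10}\cdot\mu^{0,1}$ and $a^{10}\cdot M_1a^{00}=a^{10}\cdot\mu^{1,0}$; a morphism $A\to B$ of $M_1$-algebras is a pair of $M_0$-morphisms $h_i\colon A_i\to B_i$ with $h_1\cdot a^{10}=b^{10}\cdot M_1h_0$. $A$ is canonical if for every $M_1$-algebra $B$ every $M_0$-morphism $A_0\to B_0$ extends uniquely to a morphism $A\to B$ of $M_1$-algebras. The $M_1$-algebras $(M_nX,M_{n+1}X)$, with the multiplications as structure maps, are canonical. The logic $\mathcal{L}_{\mathsf{Prob}}$ has the truth constant $\top$, a unary modality $\langle a\rangle$ for each $a\in\mathcal{A}$, and no propositional operators; its formulae of uniform depth $0$ and $n+1$ are,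 respectively, $\top$ and $\langle a\rangle\varphi$ with $\varphi$ of uniform depth $n$. The truth values are $\Omega=[0,1]$, an $M_0$-algebra with structure map $o$ given by expected values. For a canonical $M_1$-algebra $A$ and an $M_0$-morphism $f\colon A_0\to\Omega$, the map $[\![\langle a\rangle]\!](f)\colon A_1\to\Omega$ is the unique $M_0$-morphism that extends $f$ to an $M_1$-morphism from $A$ to the $M_1$-algebra with carriers $(\Omega,\Omega)$ and structure maps $o$, $o$ and $M_1\Omega\to\Omega$, $\xi\mapsto\sum_{r\in[0,1]}\xi(a,r)\cdot r$. The evaluation $[\![\varphi]\!]\colon M_n1\to\Omega$ of a formula $\varphi$ of uniform depth $n$ is given by $[\![\top]\!]=o\cdot M_0(1\mapsto 1)$ and $[\![\langle a\rangle\varphi]\!]=[\![\langle a\rangle]\!]([\![\varphi]\!])$. For a coalgebra $\gamma\colon X\to\mathcal{S}(\mathcal{A}\times X)=M_1X$ on a poset $X$ (monotone $\gamma$), put $\gamma^{(0)}=\eta_X$ and $\gamma^{(n+1)}=\mu^{1,n}\cdot M_1\gamma^{(n)}\cdot\gamma$. A state $y$ of a coalgebra $\delta\colon Y\to\mathcal{S}(\mathcal{A}\times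 Y)$ refines a state $x$ of $\gamma$ (probabilistic trace inclusion) if $(M_n!\cdot\gamma^{(n)})(x)\le(M_n!\cdot\delta^{(n)})(y)$ in $M_n1$ for all $n$, where $!$ is the map to the one-point poset $1$. A set of monotone maps $X\to Y$ between posets is jointly order-reflecting if $f(x)\le f(x')$ for all $f$ in the set implies $x\le x'$. Proposition. (1) $\mathcal{L}_{\mathsf{Prob}}$ is depth-1 separating: for every canonical $M_1$-algebra $A$ and every jointly order-reflecting set $\mathfrak{A}$ of $M_0$-morphisms $A_0\to\Omega$, the set $\{[\![\langle a\rangle]\!](f)\colon A_1\to\Omega\mid a\in\mathcal{A},\,f\in\mathfrak{A}\}$ is jointly order-reflecting. (2) $\mathcal{L}_{\mathsf{Prob}}$ is expressive for probabilistic trace inclusion: for all states $x$, $y$ in coalgebras $\gamma\colon X\to\mathcal{S}(\mathcal{A}\times X)$ and $\delta\colon Y\to\mathcal{S}(\mathcal{A}\times Y)$, if $[\![\varphi]\!]\bigl((M_n!\cdot\gamma^{(n)})(x)\bigr)\le[\![\varphi]\!]\bigl((M_n!\cdot\delta^{(n)})(y)\bigr)$ for every $n$ and every formula $\varphi$ of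 uniform depth $n$, then $y$ refines $x$. -/

import Mathlib

open scoped NNReal

namespace ProbTrace

universe u

/-! ### Discrete posets and finitely supported subdistributions -/

/-- The set `α` as a discretely ordered poset. -/
@[ext]
structure Disc (α : Type u) : Type u where
  val : α

instance (α : Type u) : PartialOrder (Disc α) where
  le a b := a = b
  le_refl _ := rfl
  le_trans _ _ _ h k := h.trans k
  le_antisymm _ _ h _ := h

/-- A finitely supported subdistribution on `X`. -/
@[ext]
structure SubDist (X : Type u) : Type u where
  weight : X →₀ ℝ≥0
  total_le_one : (weight.sum fun _ p => p) ≤ 1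

/-- A formal subconvex combination `∑ i, p i • x i` with positive coefficients. -/
structure FormalSum (X : Type u) : Type u where
  size : ℕ
  coeff : Fin size → ℝ≥0
  point : Fin size → X
  coeff_pos : ∀ i, 0 < coeff i
  total_le_one : ∑ i, coeff i ≤ 1

/-- The formal sum `d` represents `μ`: every `x` has weight `∑ (p i | x i = x)`. -/
def FormalSum.Represents {X : Type u} (d : FormalSum X) (μ : SubDist X) : Prop :=
  μ.weight = ∑ i, Finsupp.single (d.point i) (d.coeff i)

/-- `d` is a subdivision of `e`: each summand `p i • x i` of `e` is split into
summands `p' j • x i` of `d` with `∑ j, p' j = p i`. -/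
def FormalSum.IsSubdivisionOf {X : Type u} (d e : FormalSum X) : Prop :=
  ∃ g : Fin d.size → Fin e.size,
    (∀ j, d.point j = e.point (g j)) ∧
      ∀ i, ∑ j with g j = i, d.coeff j = e.coeff i

/-- `d` is obviously below `e`. -/
def FormalSum.ObviouslyBelow {X : Type u} [PartialOrder X] (d e : FormalSum X) : Prop :=
  ∃ f : Fin d.size → Fin e.size, Function.Injective f ∧
    ∀ i, d.coeff i ≤ e.coeff (f i) ∧ d.point i ≤ e.point (f i)

/-- The order on subdistributions: `μ` and `ν` are represented by formal sums that have
subdivisions `d₁`, `d₂` with `d₁` obviously below `d₂`. -/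
instance {X : Type u} [PartialOrder X] : LE (SubDist X) where
  le μ ν := ∃ e₁ e₂ : FormalSum X, e₁.Represents μ ∧ e₂.Represents ν ∧
    ∃ d₁ d₂ : FormalSum X, d₁.IsSubdivisionOf e₁ ∧ d₂.IsSubdivisionOf e₂ ∧
      d₁.ObviouslyBelow d₂

/-! ### The order on subdistributions is a partial order -/

/-- Total mass, as a linear map. -/
noncomputable def mass (X : Type u) : (X →₀ ℝ≥0) →ₗ[ℝ≥0] ℝ≥0 :=
  Finsupp.linearCombination ℝ≥0 fun _ => 1

theorem mass_eq {X : Type u} (v : X →₀ ℝ≥0) : mass X v = v.sum fun _ p => p := by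
  simp [mass, Finsupp.linearCombination_apply]

theorem SubDist.mass_le {X : Type u} (μ : SubDist X) : mass X μ.weight ≤ 1 := by
  rw [mass_eq]; exact μ.total_le_one

theorem mass_single {X : Type u} (x : X) (p : ℝ≥0) : mass X (Finsupp.single x p) = p := by
  simp [mass]

theorem mass_lmap {X Y : Type u} (f : X → Y) (v : X →₀ ℝ≥0) :
    mass Y (v.mapDomain f) = mass X v := by
  simp only [mass, Finsupp.linearCombination_mapDomain]; rfl

theorem linComb_mono {X : Type u} {E : Type*} [AddCommMonoid E] [PartialOrder E]
    [IsOrderedAddMonoid E] [Module ℝ≥0 E] (hE : ∀ (r : ℝ≥0) (a : E), 0 ≤ a → 0 ≤ r • a)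
    (k : X → E) (hk : ∀ x, 0 ≤ k x) {v w : X →₀ ℝ≥0} (h : v ≤ w) :
    Finsupp.linearCombination ℝ≥0 k v ≤ Finsupp.linearCombination ℝ≥0 k w := by
  obtain ⟨z, rfl⟩ := exists_add_of_le h
  rw [map_add]
  refine le_add_of_nonneg_right ?_
  rw [Finsupp.linearCombination_apply]
  exact Finset.sum_nonneg fun x _ => hE _ _ (hk x)

theorem mass_mono {X : Type u} {v w : X →₀ ℝ≥0} (h : v ≤ w) : mass X v ≤ mass X w :=
  linComb_mono (fun _ _ _ => zero_le) _ (fun _ => zero_le) h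

theorem linComb_le_mass {X : Type u} {v : X →₀ ℝ≥0} (k : X → ℝ≥0) (hk : ∀ x, k x ≤ 1) :
    Finsupp.linearCombination ℝ≥0 k v ≤ mass X v := by
  rw [mass, Finsupp.linearCombination_apply, Finsupp.linearCombination_apply]
  exact Finset.sum_le_sum fun x _ => mul_le_mul_right (hk x) _

/-- Couplings: a combinatorial form of the order on subdistributions. -/
def Coupled {X : Type u} [PartialOrder X] (v w : X →₀ ℝ≥0) : Prop :=
  ∃ ω : (X × X) →₀ ℝ≥0, (∀ p, ω p ≠ 0 → p.1 ≤ p.2) ∧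
    ω.mapDomain Prod.fst = v ∧ ω.mapDomain Prod.snd ≤ w

theorem FormalSum.IsSubdivisionOf.represents {X : Type u} {d e : FormalSum X} {μ : SubDist X}
    (h : d.IsSubdivisionOf e) (he : e.Represents μ) : d.Represents μ := by
  obtain ⟨g, hg, hs⟩ := h
  unfold FormalSum.Represents at *
  rw [he]
  rw [← Finset.sum_fiberwise (s := Finset.univ) (g := g)]
  refine Finset.sum_congr rfl fun i _ => ?_
  rw [← hs i, Finsupp.single_finsetSum]
  refine Finset.sum_congr rfl fun j hj => ?_
  rw [hg j, (Finset.mem_filter.mp hj).2]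

theorem FormalSum.isSubdivisionOf_refl {X : Type u} (d : FormalSum X) : d.IsSubdivisionOf d :=
  ⟨id, fun _ => rfl, fun i => by simp [Finset.filter_eq']⟩

theorem SubDist.le_iff_formal {X : Type u} [PartialOrder X] {μ ν : SubDist X} :
    μ ≤ ν ↔ ∃ d e : FormalSum X, d.Represents μ ∧ e.Represents ν ∧ d.ObviouslyBelow e := by
  constructor
  · rintro ⟨e₁, e₂, h₁, h₂, d₁, d₂, k₁, k₂, hb⟩
    exact ⟨d₁, d₂, k₁.represents h₁, k₂.represents h₂, hb⟩
  · rintro ⟨d, e, h₁, h₂, hb⟩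
    exact ⟨d, e, h₁, h₂, d, e, d.isSubdivisionOf_refl, e.isSubdivisionOf_refl, hb⟩

/-- A finite family of points with positive coefficients, as a formal sum. -/
theorem exists_formalSum {X ι : Type u} [Fintype ι] (c : ι → ℝ≥0) (pt : ι → X)
    (hc : ∀ i, 0 < c i) (ht : ∑ i, c i ≤ 1) :
    ∃ (d : FormalSum X) (σ : Fin d.size ≃ ι), (∀ i, d.coeff i = c (σ i)) ∧
      ∀ i, d.point i = pt (σ i) := by
  let σ := (Fintype.equivFin ι).symm
  refine ⟨⟨Fintype.card ι, c ∘ σ, pt ∘ σ, fun i => hc _, ?_⟩, σ, fun _ => rfl, fun _ => rfl⟩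
  rw [← Equiv.sum_comp σ] at ht
  exact ht

theorem SubDist.le_iff {X : Type u} [PartialOrder X] {μ ν : SubDist X} :
    μ ≤ ν ↔ Coupled μ.weight ν.weight := by
  classical
  rw [SubDist.le_iff_formal]
  constructor
  · rintro ⟨d, e, hd, he, f, hf, hle⟩
    refine ⟨∑ i, Finsupp.single (d.point i, e.point (f i)) (d.coeff i), ?_, ?_, ?_⟩
    · intro p hp
      rw [Finsupp.finsetSum_apply] at hp
      obtain ⟨i, -, hi⟩ := Finset.exists_ne_zero_of_sum_ne_zero hp
      rw [Finsupp.single_apply] at hi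
      split_ifs at hi with h
      · subst h; exact (hle i).2
      · exact absurd rfl hi
    · rw [hd, Finsupp.mapDomain_finsetSum]
      simp [Finsupp.mapDomain_single]
    · rw [he, Finsupp.mapDomain_finsetSum]
      simp only [Finsupp.mapDomain_single]
      calc ∑ i, Finsupp.single (e.point (f i)) (d.coeff i)
          ≤ ∑ i, Finsupp.single (e.point (f i)) (e.coeff (f i)) :=
            Finset.sum_le_sum fun i _ => Finsupp.single_le_single.mpr (hle i).1
        _ = ∑ j ∈ Finset.univ.map ⟨f, hf⟩, Finsupp.single (e.point j) (e.coeff j) := by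
            rw [Finset.sum_map]; rfl
        _ ≤ _ := Finset.sum_le_sum_of_subset (Finset.subset_univ _)
  · rintro ⟨ω, hω, h₁, h₂⟩
    set ρ := ν.weight - ω.mapDomain Prod.snd with hρ
    have hν : ω.mapDomain Prod.snd + ρ = ν.weight := add_tsub_cancel_of_le h₂
    have pos : ∀ {Y : Type u} (v : Y →₀ ℝ≥0) (i : v.support), 0 < v i := fun v i =>
      pos_iff_ne_zero.mpr (Finsupp.mem_support_iff.mp i.2)
    have sm : ∀ {Y : Type u} (v : Y →₀ ℝ≥0), ∑ i : v.support, v i = mass Y v := fun v => by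
      rw [mass_eq, Finsupp.sum, Finset.sum_coe_sort v.support (fun i => v i)]
    have sg : ∀ {Y Z : Type u} (v : Y →₀ ℝ≥0) (f : Y → Z),
        ∑ i : v.support, Finsupp.single (f i) (v i) = v.mapDomain f := fun v f => by
      rw [Finsupp.mapDomain, Finsupp.sum,
        Finset.sum_coe_sort v.support (fun i => Finsupp.single (f i) (v i))]
    obtain ⟨d, σ, hc, hp⟩ := exists_formalSum (fun i : ω.support => ω i)
      (fun i => i.1.1) (pos ω) (by
        rw [sm, ← mass_lmap Prod.fst, h₁]; exact μ.mass_le)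
    obtain ⟨e, τ, hc', hp'⟩ := exists_formalSum
      (Sum.elim (fun i : ω.support => ω i) (fun i : ρ.support => ρ i))
      (Sum.elim (fun i => i.1.2) (fun i => i.1))
      (by rintro (i | i)
          · exact pos ω i
          · exact pos ρ i)
      (by
        rw [Fintype.sum_sum_type]
        simp only [Sum.elim_inl, Sum.elim_inr]
        rw [sm, sm, ← mass_lmap Prod.snd, ← map_add, hν]; exact ν.mass_le)
    refine ⟨d, e, ?_, ?_, fun i => τ.symm (Sum.inl (σ i)), ?_, ?_⟩
    · unfold FormalSum.Represents
      simp only [hc, hp]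
      rw [Equiv.sum_comp σ (fun i => Finsupp.single i.1.1 (ω i)), sg ω Prod.fst, h₁]
    · unfold FormalSum.Represents
      simp only [hc', hp']
      rw [Equiv.sum_comp τ (fun i => Finsupp.single
          (Sum.elim (fun i : ω.support => i.1.2) (fun i : ρ.support => i.1) i)
          (Sum.elim (fun i : ω.support => ω i) (fun i : ρ.support => ρ i) i)),
        Fintype.sum_sum_type]
      simp only [Sum.elim_inl, Sum.elim_inr]
      rw [sg ω Prod.snd, sg ρ (fun x => x), ← hν]
      congr 1
      exact Finsupp.mapDomain_id.symm
    · intro i j hij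
      simpa using hij
    · intro i
      simp only [hc, hp, hc', hp', Equiv.apply_symm_apply, Sum.elim_inl]
      exact ⟨le_rfl, hω _ (Finsupp.mem_support_iff.mp (σ i).2)⟩

theorem linComb_congr {X : Type u} {E : Type*} [AddCommMonoid E] [Module ℝ≥0 E]
    {k l : X → E} (v : X →₀ ℝ≥0) (h : ∀ x, v x ≠ 0 → k x = l x) :
    Finsupp.linearCombination ℝ≥0 k v = Finsupp.linearCombination ℝ≥0 l v := by
  rw [Finsupp.linearCombination_apply, Finsupp.linearCombination_apply]
  exact Finset.sum_congr rfl fun x hx => by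
    dsimp only; rw [h x (Finsupp.mem_support_iff.mp hx)]

theorem mapDomain_linComb {X Y Z : Type u} (f : Y → Z) (k : X → (Y →₀ ℝ≥0)) (v : X →₀ ℝ≥0) :
    (Finsupp.linearCombination ℝ≥0 k v).mapDomain f =
      Finsupp.linearCombination ℝ≥0 (fun x => (k x).mapDomain f) v :=
  Finsupp.apply_linearCombination ℝ≥0 (Finsupp.lmapDomain ℝ≥0 ℝ≥0 f) k v

theorem mapDomain_eq_linComb {X Y : Type u} (f : X → Y) (v : X →₀ ℝ≥0) :
    v.mapDomain f = Finsupp.linearCombination ℝ≥0 (fun x => Finsupp.single (f x) 1) v := by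
  rw [Finsupp.linearCombination_apply, Finsupp.mapDomain]
  simp

theorem mapDomain_const {X Y : Type u} (a : Y) (v : X →₀ ℝ≥0) :
    v.mapDomain (fun _ => a) = Finsupp.single a (mass X v) := by
  rw [mapDomain_eq_linComb, mass, ← Finsupp.lsingle_apply (R := ℝ≥0),
    ← Finsupp.lsingle_apply (R := ℝ≥0), Finsupp.apply_linearCombination]
  rfl

theorem le_mapDomain {X Y : Type u} (f : X → Y) (v : X →₀ ℝ≥0) (x : X) :
    v x ≤ v.mapDomain f (f x) := by
  classical
  have h : Finsupp.single x (v x) ≤ v := by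
    intro y
    rw [Finsupp.single_apply]
    split_ifs with h
    · rw [h]
    · exact zero_le
  obtain ⟨w, hw⟩ := exists_add_of_le h
  conv_rhs => rw [hw, Finsupp.mapDomain_add, Finsupp.mapDomain_single]
  simp

/-- Weights are combined along a kernel. -/
theorem Coupled.bind {X Y : Type u} [PartialOrder X] [PartialOrder Y] {v w : X →₀ ℝ≥0}
    (h : Coupled v w) {k l : X → (Y →₀ ℝ≥0)} (hk : ∀ x y, x ≤ y → Coupled (k x) (l y)) :
    Coupled (Finsupp.linearCombination ℝ≥0 k v) (Finsupp.linearCombination ℝ≥0 l w) := by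
  classical
  obtain ⟨ω, hω, rfl, h₂⟩ := h
  choose c hc using hk
  let C : X × X → (Y × Y →₀ ℝ≥0) := fun p => if h : p.1 ≤ p.2 then c p.1 p.2 h else 0
  have hC : ∀ p, ω p ≠ 0 → ∃ h : p.1 ≤ p.2, C p = c p.1 p.2 h := fun p hp =>
    ⟨hω p hp, dif_pos (hω p hp)⟩
  refine ⟨Finsupp.linearCombination ℝ≥0 C ω, ?_, ?_, ?_⟩
  · intro q hq
    rw [Finsupp.linearCombination_apply, Finsupp.sum, Finsupp.finsetSum_apply] at hq
    obtain ⟨p, hp, hpq⟩ := Finset.exists_ne_zero_of_sum_ne_zero hq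
    obtain ⟨hle, hCp⟩ := hC p (Finsupp.mem_support_iff.mp hp)
    rw [hCp, Finsupp.smul_apply] at hpq
    exact (hc _ _ hle).1 q (right_ne_zero_of_smul hpq)
  · rw [mapDomain_linComb, Finsupp.linearCombination_mapDomain]
    refine linComb_congr _ fun p hp => ?_
    obtain ⟨hle, hCp⟩ := hC p hp
    rw [hCp, (hc _ _ hle).2.1]; rfl
  · rw [mapDomain_linComb]
    calc _ ≤ Finsupp.linearCombination ℝ≥0 (l ∘ Prod.snd) ω := by
          rw [Finsupp.linearCombination_apply, Finsupp.linearCombination_apply]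
          refine Finset.sum_le_sum fun p hp => ?_
          obtain ⟨hle, hCp⟩ := hC p (Finsupp.mem_support_iff.mp hp)
          dsimp only
          rw [hCp]
          intro y
          exact mul_le_mul_right ((hc _ _ hle).2.2 y) _
      _ = Finsupp.linearCombination ℝ≥0 l (ω.mapDomain Prod.snd) :=
          (Finsupp.linearCombination_mapDomain _ _ _).symm
      _ ≤ _ := linComb_mono (fun _ _ _ => zero_le) _ (fun _ => zero_le) h₂

theorem Coupled.refl {X : Type u} [PartialOrder X] (v : X →₀ ℝ≥0) : Coupled v v := by
  classical
  refine ⟨v.mapDomain fun x => (x, x), ?_, ?_, ?_⟩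
  · intro p hp
    obtain ⟨x, -, rfl⟩ := Finset.mem_image.mp
      (Finsupp.mapDomain_support (Finsupp.mem_support_iff.mpr hp))
    exact le_rfl
  · rw [← Finsupp.mapDomain_comp]; exact Finsupp.mapDomain_id
  · rw [← Finsupp.mapDomain_comp]; exact (Finsupp.mapDomain_id (v := v)).le

theorem Coupled.trans {X : Type u} [PartialOrder X] {a b c : X →₀ ℝ≥0}
    (h : Coupled a b) (k : Coupled b c) : Coupled a c := by
  classical
  obtain ⟨ω, hω, rfl, hωb⟩ := h
  obtain ⟨τ, hτ, rfl, hτc⟩ := k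
  set b := τ.mapDomain Prod.fst with hb
  -- the conditional distribution of the second component of `τ`
  let T : X → (X × X →₀ ℝ≥0) := fun y => τ.filter fun q => q.1 = y
  let K : X → (X →₀ ℝ≥0) := fun y => (b y)⁻¹ • (T y).mapDomain Prod.snd
  have hTfst : ∀ y, (T y).mapDomain Prod.fst = Finsupp.single y (b y) := by
    intro y
    have hadd : b = (T y).mapDomain Prod.fst +
        (τ.filter fun q => ¬ q.1 = y).mapDomain Prod.fst := by
      rw [← Finsupp.mapDomain_add, Finsupp.filter_add_filter_not]
    have h0 : ∀ z, z ≠ y → (T y).mapDomain Prod.fst z = 0 := by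
      intro z hz
      by_contra hne
      obtain ⟨q, hq, rfl⟩ := Finset.mem_image.mp
        (Finsupp.mapDomain_support (Finsupp.mem_support_iff.mpr hne))
      rw [Finsupp.support_filter, Finset.mem_filter] at hq
      exact hz hq.2
    have h1 : (τ.filter fun q => ¬ q.1 = y).mapDomain Prod.fst y = 0 := by
      by_contra hne
      obtain ⟨q, hq, hqy⟩ := Finset.mem_image.mp
        (Finsupp.mapDomain_support (Finsupp.mem_support_iff.mpr hne))
      rw [Finsupp.support_filter, Finset.mem_filter] at hq
      exact hq.2 hqy
    ext z
    rw [Finsupp.single_apply]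
    split_ifs with hzy
    · subst hzy
      conv_rhs => rw [hadd]
      rw [Finsupp.add_apply, h1, add_zero]
    · rw [h0 z (Ne.symm hzy)]
  have hK : ∀ y, b y ≠ 0 → mass X (K y) = 1 := by
    intro y hy
    rw [map_smul, mass_lmap, ← mass_lmap Prod.fst, hTfst, mass_single, smul_eq_mul,
      inv_mul_cancel₀ hy]
  have hbsum : Finsupp.linearCombination ℝ≥0 K b = τ.mapDomain Prod.snd := by
    have e1 : Finsupp.linearCombination ℝ≥0 K b =
        (∑ y ∈ b.support, T y).mapDomain Prod.snd := by
      rw [Finsupp.linearCombination_apply, Finsupp.sum, Finsupp.mapDomain_finsetSum]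
      refine Finset.sum_congr rfl fun y hy => ?_
      rw [smul_smul, mul_inv_cancel₀ (Finsupp.mem_support_iff.mp hy), one_smul]
    rw [e1]
    congr 1
    ext q
    rw [Finsupp.finsetSum_apply]
    simp only [T, Finsupp.filter_apply]
    rw [Finset.sum_ite_eq]
    split_ifs with hq
    · rfl
    · by_contra hne
      apply hq
      rw [Finsupp.mem_support_iff]
      intro h0
      have := le_mapDomain Prod.fst τ q
      rw [← hb, h0] at this
      have h5 := (le_antisymm this zero_le).symm
      exact hne (by exact_mod_cast h5)
  have hωpos : ∀ p, ω p ≠ 0 → b p.2 ≠ 0 := by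
    intro p hp h0
    have := (le_mapDomain Prod.snd ω p).trans (hωb p.2)
    rw [h0] at this
    exact hp (le_antisymm this zero_le)
  refine ⟨Finsupp.linearCombination ℝ≥0
    (fun p : X × X => (K p.2).mapDomain fun z => (p.1, z)) ω, ?_, ?_, ?_⟩
  · intro q hq
    rw [Finsupp.linearCombination_apply, Finsupp.sum, Finsupp.finsetSum_apply] at hq
    obtain ⟨p, hp, hpq⟩ := Finset.exists_ne_zero_of_sum_ne_zero hq
    have h1 := right_ne_zero_of_smul hpq
    obtain ⟨z, hz, rfl⟩ := Finset.mem_image.mp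
      (Finsupp.mapDomain_support (Finsupp.mem_support_iff.mpr h1))
    have h2 : (T p.2).mapDomain Prod.snd z ≠ 0 :=
      right_ne_zero_of_smul (Finsupp.mem_support_iff.mp hz)
    obtain ⟨r, hr, rfl⟩ := Finset.mem_image.mp
      (Finsupp.mapDomain_support (Finsupp.mem_support_iff.mpr h2))
    rw [Finsupp.support_filter, Finset.mem_filter] at hr
    have h3 := hω p (Finsupp.mem_support_iff.mp hp)
    have h4 := hτ r (Finsupp.mem_support_iff.mp hr.1)
    rw [hr.2] at h4
    exact h3.trans h4
  · rw [mapDomain_linComb, mapDomain_eq_linComb Prod.fst]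
    refine linComb_congr _ fun p hp => ?_
    rw [← Finsupp.mapDomain_comp]
    have : (Prod.fst ∘ fun z : X => (p.1, z)) = fun _ => p.1 := rfl
    rw [this, mapDomain_const, hK p.2 (hωpos p hp)]
  · rw [mapDomain_linComb]
    have : (fun p : X × X => ((K p.2).mapDomain fun z => (p.1, z)).mapDomain Prod.snd) =
        K ∘ Prod.snd := by
      funext p
      rw [← Finsupp.mapDomain_comp]
      exact Finsupp.mapDomain_id
    rw [this, ← Finsupp.linearCombination_mapDomain]
    refine le_trans ?_ hτc
    rw [← hbsum]
    exact linComb_mono (fun _ _ _ => zero_le) _ (fun _ => zero_le) hωb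

/-- Weights of upper sets are monotone. -/
theorem Coupled.upper {X : Type u} [PartialOrder X] {v w : X →₀ ℝ≥0} (h : Coupled v w)
    (f : X → ℝ≥0) (hf : Monotone f) :
    Finsupp.linearCombination ℝ≥0 f v ≤ Finsupp.linearCombination ℝ≥0 f w := by
  obtain ⟨ω, hω, rfl, h₂⟩ := h
  refine le_trans ?_ (linComb_mono (fun _ _ _ => zero_le) _ (fun _ => zero_le) h₂)
  rw [Finsupp.linearCombination_mapDomain, Finsupp.linearCombination_mapDomain,
    Finsupp.linearCombination_apply, Finsupp.linearCombination_apply]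
  exact Finset.sum_le_sum fun p hp =>
    mul_le_mul_right (hf (hω p (Finsupp.mem_support_iff.mp hp))) _

theorem Coupled.antisymm {X : Type u} [PartialOrder X] {v w : X →₀ ℝ≥0}
    (h : Coupled v w) (k : Coupled w v) : v = w := by
  classical
  have key : ∀ f : X → ℝ≥0, Monotone f →
      Finsupp.linearCombination ℝ≥0 f v = Finsupp.linearCombination ℝ≥0 f w :=
    fun f hf => le_antisymm (h.upper f hf) (k.upper f hf)
  ext x
  let f : X → ℝ≥0 := fun y => if x ≤ y then 1 else 0
  let g : X → ℝ≥0 := fun y => if x < y then 1 else 0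
  have hf : Monotone f := by
    intro y z hyz
    simp only [f]
    split_ifs with h1 h2
    · exact le_rfl
    · exact absurd (h1.trans hyz) h2
    · exact zero_le
    · exact le_rfl
  have hg : Monotone g := by
    intro y z hyz
    simp only [g]
    split_ifs with h1 h2
    · exact le_rfl
    · exact absurd (h1.trans_le hyz) h2
    · exact zero_le
    · exact le_rfl
  have hfg : ∀ u : X →₀ ℝ≥0, Finsupp.linearCombination ℝ≥0 f u =
      u x + Finsupp.linearCombination ℝ≥0 g u := by
    intro u
    have : f = fun y => (Pi.single x 1 : X → ℝ≥0) y + g y := by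
      funext y
      simp only [f, g, Pi.single_apply]
      by_cases hxy : y = x
      · subst hxy; simp
      · simp [hxy, lt_iff_le_and_ne, Ne.symm hxy]
    rw [this]
    simp only [Finsupp.linearCombination_apply, Finsupp.sum, smul_add, Finset.sum_add_distrib]
    congr 1
    simp [Pi.single_apply, eq_comm]
  have h1 := key f hf
  rw [hfg, hfg, key g hg] at h1
  exact_mod_cast add_right_cancel h1

instance {X : Type u} [PartialOrder X] : PartialOrder (SubDist X) where
  le_refl μ := SubDist.le_iff.mpr (Coupled.refl _)
  le_trans _ _ _ h k :=
    SubDist.le_iff.mpr ((SubDist.le_iff.mp h).trans (SubDist.le_iff.mp k))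
  le_antisymm _ _ h k :=
    SubDist.ext ((SubDist.le_iff.mp h).antisymm (SubDist.le_iff.mp k))

/-! ### The subdistribution monad -/

/-- Functorial action of `𝒮`: the image subdistribution. -/
noncomputable def SubDist.map {X Y : Type u} (f : X → Y) (μ : SubDist X) : SubDist Y where
  weight := μ.weight.mapDomain f
  total_le_one := by rw [← mass_eq, mass_lmap]; exact μ.mass_le

/-- The point distribution `1 • x`. -/
noncomputable def SubDist.pure {X : Type u} (x : X) : SubDist X where
  weight := Finsupp.single x 1
  total_le_one := by rw [← mass_eq, mass_single]

/-- The subdistribution `∑ x, μ x • k x`. -/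
noncomputable def SubDist.bind {X Y : Type u} (μ : SubDist X) (k : X → SubDist Y) :
    SubDist Y where
  weight := Finsupp.linearCombination ℝ≥0 (fun x => (k x).weight) μ.weight
  total_le_one := by
    rw [← mass_eq, mass, Finsupp.linearCombination_linearCombination]
    exact (linComb_le_mass _ fun x => (k x).mass_le).trans μ.mass_le

theorem SubDist.bind_mono {X Y : Type u} [PartialOrder X] [PartialOrder Y] {k l : X → SubDist Y}
    (hk : ∀ x y, x ≤ y → k x ≤ l y) {μ ν : SubDist X} (h : μ ≤ ν) : μ.bind k ≤ ν.bind l :=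
  SubDist.le_iff.mpr ((SubDist.le_iff.mp h).bind fun x y hxy => SubDist.le_iff.mp (hk x y hxy))

theorem SubDist.map_eq_bind {X Y : Type u} (f : X → Y) (μ : SubDist X) :
    μ.map f = μ.bind fun x => SubDist.pure (f x) :=
  SubDist.ext (mapDomain_eq_linComb _ _)

theorem SubDist.pure_mono {X : Type u} [PartialOrder X] {x y : X} (h : x ≤ y) :
    SubDist.pure x ≤ SubDist.pure y := by
  classical
  refine SubDist.le_iff.mpr ⟨Finsupp.single (x, y) 1, ?_, ?_, ?_⟩
  · intro p hp
    rw [Finsupp.single_apply] at hp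
    split_ifs at hp with he
    · subst he; exact h
    · exact absurd rfl hp
  · rw [Finsupp.mapDomain_single]; rfl
  · rw [Finsupp.mapDomain_single]; exact le_rfl

theorem SubDist.map_mono {X Y : Type u} [PartialOrder X] [PartialOrder Y] {f : X → Y}
    (hf : Monotone f) : Monotone (SubDist.map f) := by
  intro μ ν h
  rw [SubDist.map_eq_bind, SubDist.map_eq_bind]
  exact SubDist.bind_mono (fun x y hxy => SubDist.pure_mono (hf hxy)) h

theorem SubDist.map_map {X Y Z : Type u} (f : X → Y) (g : Y → Z) (μ : SubDist X) :
    (μ.map f).map g = μ.map (g ∘ f) :=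
  SubDist.ext Finsupp.mapDomain_comp.symm

theorem SubDist.map_id {X : Type u} (μ : SubDist X) : μ.map (fun x => x) = μ :=
  SubDist.ext Finsupp.mapDomain_id

theorem SubDist.map_bind {X Y Z : Type u} (k : X → SubDist Y) (g : Y → Z) (μ : SubDist X) :
    (μ.bind k).map g = μ.bind fun x => (k x).map g :=
  SubDist.ext (mapDomain_linComb _ _ _)

theorem SubDist.bind_map {X Y Z : Type u} (f : X → Y) (k : Y → SubDist Z) (μ : SubDist X) :
    (μ.map f).bind k = μ.bind fun x => k (f x) :=
  SubDist.ext (Finsupp.linearCombination_mapDomain _ _ _)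

theorem SubDist.pure_bind {X Y : Type u} (x : X) (k : X → SubDist Y) :
    (SubDist.pure x).bind k = k x :=
  SubDist.ext (by simp [SubDist.bind, SubDist.pure])

theorem SubDist.bind_bind {X Y Z : Type u} (k : X → SubDist Y) (l : Y → SubDist Z)
    (μ : SubDist X) : (μ.bind k).bind l = μ.bind fun x => (k x).bind l :=
  SubDist.ext (Finsupp.linearCombination_linearCombination ℝ≥0 _ _ _)

theorem SubDist.map_pure {X Y : Type u} (f : X → Y) (x : X) :
    (SubDist.pure x).map f = SubDist.pure (f x) :=
  SubDist.ext Finsupp.mapDomain_single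

/-! ### The graded monad `M n X = 𝒮(𝒜ⁿ × X)` -/

/-- Words of length `n` over `𝒜`, discretely ordered. -/
abbrev Word (𝒜 : Type u) (n : ℕ) : Type u := Disc (List.Vector 𝒜 n)

/-- The empty word. -/
def Word.nil {𝒜 : Type u} : Word 𝒜 0 := ⟨List.Vector.nil⟩

/-- The word of length one with letter `a`. -/
def Word.letter {𝒜 : Type u} (a : 𝒜) : Word 𝒜 1 := ⟨⟨[a], rfl⟩⟩

/-- Concatenation of words. -/
def Word.append {𝒜 : Type u} {n k m : ℕ} (h : n + k = m) (v : Word 𝒜 n) (w : Word 𝒜 k) :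
    Word 𝒜 m :=
  ⟨⟨v.val.1 ++ w.val.1, by rw [List.length_append, v.val.2, w.val.2, h]⟩⟩

theorem Word.ext_list {𝒜 : Type u} {n : ℕ} {v w : Word 𝒜 n} (h : v.val.1 = w.val.1) : v = w :=
  Disc.ext (Subtype.ext h)

/-- `M n X = 𝒮(𝒜ⁿ × X)`, with the product order on `𝒜ⁿ × X`. -/
abbrev M (𝒜 : Type u) (n : ℕ) (X : Type u) : Type u := SubDist (Word 𝒜 n × X)

section Monad

variable {𝒜 : Type u} {X Y Z : Type u} [PartialOrder X] [PartialOrder Y] [PartialOrder Z]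

/-- The functor `M n` on monotone maps. -/
noncomputable def mapM (n : ℕ) (f : X →o Y) : M 𝒜 n X →o M 𝒜 n Y where
  toFun := SubDist.map fun p => (p.1, f p.2)
  monotone' := SubDist.map_mono fun _ _ h => ⟨h.1, f.monotone h.2⟩

/-- The unit `η : X → M 0 X`. -/
noncomputable def unitM : X →o M 𝒜 0 X where
  toFun x := SubDist.pure (Word.nil, x)
  monotone' _ _ h := SubDist.pure_mono ⟨le_rfl, h⟩

/-- The multiplication `μ^{n,k} : M n (M k X) → M (n + k) X`, where `m = n + k`: it sends
`∑ i, p i • (v i, ∑ j, q i j • (w i j, x i j))` to `∑ i j, (p i * q i j) • (v i w i j, x i j)`. -/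
noncomputable def mult {n k m : ℕ} (h : n + k = m) : M 𝒜 n (M 𝒜 k X) →o M 𝒜 m X where
  toFun Ξ := Ξ.bind fun p => p.2.map fun q => (Word.append h p.1 q.1, q.2)
  monotone' _ _ hΞ := SubDist.bind_mono (fun p q hpq => by
    obtain ⟨v, μ⟩ := p
    obtain ⟨w, ν⟩ := q
    obtain ⟨h1, h2⟩ := hpq
    change v = w at h1
    subst h1
    have hf : Monotone fun q : Word 𝒜 k × X => (Word.append h v q.1, q.2) :=
      fun _ _ hr => ⟨congrArg (Word.append h v) hr.1, hr.2⟩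
    exact SubDist.map_mono hf h2) hΞ

theorem mapM_apply {n : ℕ} (f : X →o Y) (ξ : M 𝒜 n X) :
    mapM n f ξ = SubDist.map (fun p => (p.1, f p.2)) ξ := rfl

theorem unitM_apply (x : X) : (unitM x : M 𝒜 0 X) = SubDist.pure (Word.nil, x) := rfl

theorem mult_apply {n k m : ℕ} (h : n + k = m) (Ξ : M 𝒜 n (M 𝒜 k X)) :
    mult h Ξ = SubDist.bind Ξ fun p => SubDist.map (fun q => (Word.append h p.1 q.1, q.2)) p.2 :=
  rfl

theorem mapM_mapM {n : ℕ} (f : X →o Y) (g : Y →o Z) (ξ : M 𝒜 n X) :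
    mapM n g (mapM n f ξ) = mapM n (g.comp f) ξ :=
  SubDist.map_map _ _ _

theorem mapM_id {n : ℕ} (ξ : M 𝒜 n X) : mapM n OrderHom.id ξ = ξ :=
  SubDist.map_id _

theorem mapM_unitM (f : X →o Y) (x : X) :
    mapM 0 f (unitM x : M 𝒜 0 X) = unitM (f x) :=
  SubDist.map_pure _ _

theorem mult_mapM {n k m : ℕ} (h : n + k = m) (f : X →o Y) (Ξ : M 𝒜 n (M 𝒜 k X)) :
    mult h (mapM n (mapM k f) Ξ) = mapM m f (mult h Ξ) := by
  simp only [mult_apply, mapM_apply, SubDist.map_bind, SubDist.bind_map, SubDist.map_map]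
  rfl

theorem mult_unitM {n m : ℕ} (h : 0 + n = m) (hm : n = m) (ξ : M 𝒜 n X) :
    mult h (unitM ξ : M 𝒜 0 (M 𝒜 n X)) = hm ▸ ξ := by
  subst hm
  simp only [mult_apply, unitM_apply, SubDist.pure_bind]
  exact SubDist.map_id ξ

theorem mult_mult {a b c ab bc m : ℕ} (h₁ : a + b = ab) (h₂ : ab + c = m) (h₃ : b + c = bc)
    (h₄ : a + bc = m) (Ξ : M 𝒜 a (M 𝒜 b (M 𝒜 c X))) :
    mult h₄ (mapM a (mult h₃) Ξ) = mult h₂ (mult h₁ Ξ) := by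
  simp only [mult_apply, mapM_apply, SubDist.map_bind, SubDist.bind_map, SubDist.bind_bind,
    SubDist.map_map]
  congr 1
  funext p
  congr 1
  funext q
  congr 1
  funext r
  exact Prod.ext (Word.ext_list (List.append_assoc _ _ _).symm) rfl

end Monad

/-! ### Graded algebras -/

/-- An `M₀`-algebra. -/
structure M0Algebra (𝒜 : Type u) : Type (u + 1) where
  carrier : Type u
  [order : PartialOrder carrier]
  /-- The structure map `a^{0,0}`. -/
  str : M 𝒜 0 carrier →o carrier
  str_unit : ∀ x, str (unitM x) = x
  str_mult : ∀ Ξ : M 𝒜 0 (M 𝒜 0 carrier), str (mapM 0 str Ξ) = str (mult rfl Ξ)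

instance {𝒜 : Type u} : CoeSort (M0Algebra 𝒜) (Type u) := ⟨M0Algebra.carrier⟩

instance {𝒜 : Type u} (A : M0Algebra 𝒜) : PartialOrder A := A.order

/-- A morphism of `M₀`-algebras. -/
structure M0Hom {𝒜 : Type u} (A B : M0Algebra 𝒜) : Type u where
  toMap : A →o B
  map_str : ∀ ξ : M 𝒜 0 A, toMap (A.str ξ) = B.str (mapM 0 toMap ξ)

/-- An `M₁`-algebra: `M₀`-algebras `A₀`, `A₁` and a main structure map `a^{1,0} : M₁ A₀ → A₁`
that is a morphism of `M₀`-algebras and merges `μ^{1,0}` and `M₁ a^{0,0}`. -/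
structure M1Algebra (𝒜 : Type u) : Type (u + 1) where
  part₀ : M0Algebra 𝒜
  part₁ : M0Algebra 𝒜
  main : M 𝒜 1 part₀ →o part₁
  main_mult : ∀ Ξ : M 𝒜 0 (M 𝒜 1 part₀), part₁.str (mapM 0 main Ξ) = main (mult rfl Ξ)
  main_str : ∀ Ξ : M 𝒜 1 (M 𝒜 0 part₀), main (mapM 1 part₀.str Ξ) = main (mult rfl Ξ)

/-- A morphism of `M₁`-algebras. -/
structure M1Hom {𝒜 : Type u} (A B : M1Algebra 𝒜) : Type u where
  hom₀ : M0Hom A.part₀ B.part₀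
  hom₁ : M0Hom A.part₁ B.part₁
  map_main : ∀ ξ : M 𝒜 1 A.part₀, hom₁.toMap (A.main ξ) = B.main (mapM 1 hom₀.toMap ξ)

/-- An `M₁`-algebra is canonical if it is free over its `0`-part, with universal morphism the
identity: each `M₀`-morphism from its `0`-part to the `0`-part of an `M₁`-algebra `B` extends
uniquely to a morphism of `M₁`-algebras to `B`. -/
def M1Algebra.IsCanonical {𝒜 : Type u} (A : M1Algebra 𝒜) : Prop :=
  ∀ (B : M1Algebra 𝒜) (h : M0Hom A.part₀ B.part₀), ∃! F : M1Hom A B, F.hom₀ = h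

/-- The `M₀`-algebra `M n X` with structure map `μ^{0,n}`. -/
noncomputable def freeAlg (𝒜 : Type u) (n : ℕ) (X : Type u) [PartialOrder X] :
    M0Algebra 𝒜 where
  carrier := M 𝒜 n X
  str := mult (Nat.zero_add n)
  str_unit ξ := mult_unitM _ rfl ξ
  str_mult Ξ := mult_mult _ _ _ _ Ξ

/-- The `M₁`-algebra `(M n X, M (n+1) X)` with the multiplications as structure maps. -/
noncomputable def freeAlg₁ (𝒜 : Type u) (n : ℕ) (X : Type u) [PartialOrder X] :
    M1Algebra 𝒜 where
  part₀ := freeAlg 𝒜 n X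
  part₁ := freeAlg 𝒜 (n + 1) X
  main := mult (Nat.add_comm 1 n)
  main_mult Ξ := mult_mult _ _ _ _ Ξ
  main_str Ξ := mult_mult _ _ _ _ Ξ

section Canonical

variable {𝒜 : Type u} {n : ℕ} {X : Type u} [PartialOrder X]

/-- The section of `μ^{1,n}` with `∑ p • (a w, x) ↦ ∑ p • (a, 1 • (w, x))`. -/
noncomputable def splitM : M 𝒜 (n + 1) X →o M 𝒜 1 (M 𝒜 n X) where
  toFun := SubDist.map fun p =>
    (Word.letter p.1.val.head, SubDist.pure ((⟨p.1.val.tail⟩ : Word 𝒜 n), p.2))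
  monotone' := SubDist.map_mono fun p q h => by
    obtain ⟨v, x⟩ := p
    obtain ⟨w, y⟩ := q
    obtain ⟨h1, h2⟩ := h
    change v = w at h1
    subst h1
    exact ⟨le_rfl, SubDist.pure_mono ⟨le_rfl, h2⟩⟩

/-- The section of `μ^{0,n}` with `∑ p • (w, x) ↦ ∑ p • (ε, 1 • (w, x))`. -/
noncomputable def liftM : M 𝒜 n X →o M 𝒜 0 (M 𝒜 n X) where
  toFun := SubDist.map fun p => (Word.nil, SubDist.pure p)
  monotone' := SubDist.map_mono fun _ _ h => ⟨le_rfl, SubDist.pure_mono h⟩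

theorem splitM_apply (ξ : M 𝒜 (n + 1) X) :
    splitM ξ = SubDist.map (fun p =>
      (Word.letter p.1.val.head, SubDist.pure ((⟨p.1.val.tail⟩ : Word 𝒜 n), p.2))) ξ := rfl

theorem liftM_apply (ξ : M 𝒜 n X) :
    liftM ξ = SubDist.map (fun p => (Word.nil, SubDist.pure p)) ξ := rfl

theorem Word.letter_append {m : ℕ} (h : 1 + n = m) (v : Word 𝒜 1) (w : Word 𝒜 n) :
    (Word.append h v w).val.1 = v.val.head :: w.val.1 := by
  obtain ⟨⟨l, hl⟩⟩ := v
  obtain ⟨a, rfl⟩ := List.length_eq_one_iff.mp hl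
  rfl

theorem Word.letter_head (v : Word 𝒜 1) : Word.letter v.val.head = v := by
  obtain ⟨⟨l, hl⟩⟩ := v
  obtain ⟨a, rfl⟩ := List.length_eq_one_iff.mp hl
  rfl

theorem Word.head_append (v : Word 𝒜 1) (w : Word 𝒜 n) :
    (Word.append (Nat.add_comm 1 n) v w).val.head = v.val.head := by
  have h : (Word.append (Nat.add_comm 1 n) v w).val = v.val.head ::ᵥ w.val :=
    Subtype.ext (Word.letter_append _ v w)
  rw [h, List.Vector.head_cons]

theorem Word.tail_append (v : Word 𝒜 1) (w : Word 𝒜 n) :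
    (Word.append (Nat.add_comm 1 n) v w).val.tail = w.val := by
  have h : (Word.append (Nat.add_comm 1 n) v w).val = v.val.head ::ᵥ w.val :=
    Subtype.ext (Word.letter_append _ v w)
  rw [h, List.Vector.tail_cons]

theorem mult_splitM (ξ : M 𝒜 (n + 1) X) : mult (Nat.add_comm 1 n) (splitM ξ) = ξ := by
  simp only [mult_apply, splitM_apply, SubDist.bind_map, SubDist.map_pure]
  rw [← SubDist.map_eq_bind]
  conv_rhs => rw [← SubDist.map_id ξ]
  congr 1
  funext p
  refine Prod.ext (Word.ext_list ?_) rfl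
  rw [Word.letter_append]
  exact congrArg Subtype.val (List.Vector.cons_head_tail p.1.val)

theorem mult_liftM (ξ : M 𝒜 n X) : mult (Nat.zero_add n) (liftM ξ) = ξ := by
  simp only [mult_apply, liftM_apply, SubDist.bind_map, SubDist.map_pure]
  rw [← SubDist.map_eq_bind]
  exact SubDist.map_id ξ

theorem splitM_mult (Φ : M 𝒜 1 (M 𝒜 n X)) :
    splitM (mult (Nat.add_comm 1 n) Φ) = mult rfl (mapM 1 liftM Φ) := by
  simp only [mult_apply, splitM_apply, liftM_apply, mapM_apply, SubDist.bind_map, SubDist.map_bind,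
    SubDist.map_map]
  congr 1
  funext p
  congr 1
  funext q
  refine Prod.ext ?_ ?_
  · change Word.letter (Word.append (Nat.add_comm 1 n) p.1 q.1).val.head =
      Word.append (m := 1) rfl p.1 Word.nil
    rw [Word.head_append, Word.letter_head]
    exact Word.ext_list (List.append_nil _).symm
  · change SubDist.pure ((⟨(Word.append (Nat.add_comm 1 n) p.1 q.1).val.tail⟩ : Word 𝒜 n), q.2) =
      SubDist.pure q
    rw [Word.tail_append]

theorem splitM_mult_zero (Ψ : M 𝒜 0 (M 𝒜 (n + 1) X)) :
    splitM (mult (Nat.zero_add (n + 1)) Ψ) = mult rfl (mapM 0 splitM Ψ) := by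
  simp only [mult_apply, splitM_apply, mapM_apply, SubDist.bind_map, SubDist.map_bind,
    SubDist.map_map]
  congr 1
  funext p
  congr 1
  funext q
  have h : ∀ w : Word 𝒜 (n + 1), Word.append (Nat.zero_add (n + 1)) p.1 w = w := fun w =>
    Word.ext_list (by
      change p.1.val.1 ++ w.val.1 = w.val.1
      rw [List.length_eq_zero_iff.mp p.1.val.2, List.nil_append])
  have h' : ∀ w : Word 𝒜 1, Word.append (Nat.zero_add 1) p.1 w = w := fun w =>
    Word.ext_list (by
      change p.1.val.1 ++ w.val.1 = w.val.1
      rw [List.length_eq_zero_iff.mp p.1.val.2, List.nil_append])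
  simp only [Function.comp_apply, h, h']

theorem M0Hom.ext_map {A B : M0Algebra 𝒜} {f g : M0Hom A B} (h : f.toMap = g.toMap) : f = g := by
  cases f; cases g; cases h; rfl

theorem M1Hom.ext_hom {A B : M1Algebra 𝒜} {F G : M1Hom A B} (h₀ : F.hom₀ = G.hom₀)
    (h₁ : F.hom₁ = G.hom₁) : F = G := by
  cases F; cases G; cases h₀; cases h₁; rfl

theorem extend_main (B : M1Algebra 𝒜) (h : M 𝒜 n X →o B.part₀)
    (hh : ∀ ξ : M 𝒜 0 (M 𝒜 n X), h (mult (Nat.zero_add n) ξ) = B.part₀.str (mapM 0 h ξ))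
    (Φ : M 𝒜 1 (M 𝒜 n X)) :
    B.main (mapM 1 h (splitM (mult (Nat.add_comm 1 n) Φ))) = B.main (mapM 1 h Φ) := by
  rw [splitM_mult, ← mult_mapM (n := 1) (k := 0) (m := 1) rfl h, ← B.main_str, mapM_mapM,
    mapM_mapM]
  have e : (B.part₀.str.comp (mapM 0 h)).comp liftM = h := by
    refine OrderHom.ext _ _ (funext fun ν => ?_)
    change B.part₀.str (mapM 0 h (liftM ν)) = h ν
    rw [← hh, mult_liftM]
  rw [e]

theorem extend_hom (B : M1Algebra 𝒜) (h : M 𝒜 n X →o B.part₀)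
    (Ψ : M 𝒜 0 (M 𝒜 (n + 1) X)) :
    B.main (mapM 1 h (splitM (mult (Nat.zero_add (n + 1)) Ψ))) =
      B.part₁.str (mapM 0 ((B.main.comp (mapM 1 h)).comp splitM) Ψ) := by
  rw [splitM_mult_zero, ← mult_mapM (n := 0) (k := 1) (m := 1) rfl h, ← B.main_mult, mapM_mapM,
    mapM_mapM]

/-- The `M₁`-algebra `(M n X, M (n+1) X)` is canonical. -/
theorem freeAlg₁_isCanonical (𝒜 : Type u) (n : ℕ) (X : Type u) [PartialOrder X] :
    (freeAlg₁ 𝒜 n X).IsCanonical := by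
  intro B h
  let k : M0Hom (freeAlg 𝒜 (n + 1) X) B.part₁ :=
    ⟨(B.main.comp (mapM 1 h.toMap)).comp splitM, extend_hom B h.toMap⟩
  refine ⟨⟨h, k, extend_main B h.toMap h.map_str⟩, rfl, ?_⟩
  rintro F hF
  subst hF
  refine M1Hom.ext_hom rfl (M0Hom.ext_map (OrderHom.ext _ _ (funext fun ξ => ?_)))
  have h1 := F.map_main (splitM ξ)
  have h2 : (freeAlg₁ 𝒜 n X).main (splitM ξ) = ξ := mult_splitM ξ
  rw [h2] at h1
  exact h1

end Canonical

/-! ### The truth values and the modalities of the logic -/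

/-- The expected value `∑ x, μ x * v x`. -/
noncomputable def expectation {X : Type u} (v : X → unitInterval) (μ : SubDist X) :
    unitInterval :=
  ⟨μ.weight.sum fun x p => (p : ℝ) * (v x : ℝ), by
    refine ⟨Finset.sum_nonneg fun x _ => mul_nonneg (NNReal.coe_nonneg _) (v x).2.1, ?_⟩
    have h : (μ.weight.sum fun x p => (p : ℝ) * (v x : ℝ)) ≤
        ((μ.weight.sum fun _ p => p : ℝ≥0) : ℝ) := by
      rw [Finsupp.sum, Finsupp.sum, NNReal.coe_sum]
      exact Finset.sum_le_sum fun x _ =>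
        mul_le_of_le_one_right (NNReal.coe_nonneg _) (v x).2.2
    exact h.trans (by exact_mod_cast μ.total_le_one)⟩

theorem expectation_eq {X : Type u} (v : X → unitInterval) (μ : SubDist X) :
    (expectation v μ : ℝ) =
      Finsupp.linearCombination ℝ≥0 (fun x => (v x : ℝ)) μ.weight := by
  rw [Finsupp.linearCombination_apply]
  rfl

theorem expectation_map {X Y : Type u} (v : Y → unitInterval) (f : X → Y) (μ : SubDist X) :
    expectation v (μ.map f) = expectation (fun x => v (f x)) μ := by
  refine Subtype.ext ?_
  rw [expectation_eq, expectation_eq]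
  exact Finsupp.linearCombination_mapDomain _ _ _

theorem expectation_pure {X : Type u} (v : X → unitInterval) (x : X) :
    expectation v (SubDist.pure x) = v x := by
  refine Subtype.ext ?_
  rw [expectation_eq]
  simp [SubDist.pure]

theorem expectation_bind {X Y : Type u} (v : Y → unitInterval) (k : X → SubDist Y)
    (μ : SubDist X) :
    expectation v (μ.bind k) = expectation (fun x => expectation v (k x)) μ := by
  refine Subtype.ext ?_
  simp only [expectation_eq]
  exact Finsupp.linearCombination_linearCombination ℝ≥0 _ _ _

theorem expectation_zero {X : Type u} (μ : SubDist X) : expectation (fun _ => 0) μ = 0 := by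
  refine Subtype.ext ?_
  rw [expectation_eq, Finsupp.linearCombination_apply]
  simp

theorem expectation_mono {X : Type u} [PartialOrder X] {v : X → unitInterval} (hv : Monotone v)
    {μ ν : SubDist X} (h : μ ≤ ν) : expectation v μ ≤ expectation v ν := by
  change (expectation v μ : ℝ) ≤ (expectation v ν : ℝ)
  have e : ∀ ξ : SubDist X, (expectation v ξ : ℝ) =
      (Finsupp.linearCombination ℝ≥0 (fun x => unitInterval.toNNReal (v x)) ξ.weight : ℝ≥0) := by
    intro ξ
    rw [Finsupp.linearCombination_apply, Finsupp.sum, NNReal.coe_sum]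
    rfl
  rw [e, e]
  exact_mod_cast (SubDist.le_iff.mp h).upper _ fun x y hxy => hv hxy

/-- The truth values `Ω = [0,1]`. -/
abbrev Ω : Type u := ULift.{u} unitInterval

/-- The map `o : M₀ [0,1] → [0,1]` that sends formal subconvex combinations to their expected
values. -/
noncomputable def truthStr (𝒜 : Type u) : M 𝒜 0 Ω.{u} →o Ω.{u} where
  toFun ξ := ULift.up (expectation (fun p => p.2.down) ξ)
  monotone' _ _ h := expectation_mono
    (show Monotone fun p : Word 𝒜 0 × Ω.{u} => p.2.down from fun _ _ hpq => hpq.2) h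

theorem truthStr_mult (𝒜 : Type u) (Ξ : M 𝒜 0 (M 𝒜 0 Ω.{u})) :
    truthStr 𝒜 (mapM 0 (truthStr 𝒜) Ξ) = truthStr 𝒜 (mult rfl Ξ) := by
  refine congrArg ULift.up ?_
  rw [mapM_apply, mult_apply, expectation_map, expectation_bind]
  simp only [expectation_map]
  rfl

open Classical in
/-- The contribution of `(w, r)` to the value of `⟨a⟩`: `r` if `w = a`, and `0` otherwise. -/
noncomputable def diaValue {𝒜 : Type u} (a : 𝒜) (p : Word 𝒜 1 × Ω.{u}) : unitInterval :=
  if p.1 = Word.letter a then p.2.down else 0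

theorem diaValue_mono {𝒜 : Type u} (a : 𝒜) : Monotone (diaValue a) := by
  rintro ⟨v, r⟩ ⟨w, s⟩ ⟨h1, h2⟩
  change v = w at h1
  subst h1
  unfold diaValue
  split_ifs
  · exact h2
  · exact le_rfl

/-- The map `⟦⟨a⟩⟧ : M₁ [0,1] → [0,1]` that sends `ξ` to `∑ r, ξ (a, r) * r`. -/
noncomputable def diaStr {𝒜 : Type u} (a : 𝒜) : M 𝒜 1 Ω.{u} →o Ω.{u} where
  toFun ξ := ULift.up (expectation (diaValue a) ξ)
  monotone' _ _ h := expectation_mono (diaValue_mono a) h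

theorem diaStr_mult {𝒜 : Type u} (a : 𝒜) (Ξ : M 𝒜 0 (M 𝒜 1 Ω.{u})) :
    truthStr 𝒜 (mapM 0 (diaStr a) Ξ) = diaStr a (mult rfl Ξ) := by
  refine congrArg ULift.up ?_
  rw [mapM_apply, mult_apply, expectation_map, expectation_bind]
  simp only [expectation_map]
  congr 1
  funext p
  change expectation (diaValue a) p.2 = _
  congr 1
  funext q
  have h : Word.append (Nat.zero_add 1) p.1 q.1 = q.1 := Word.ext_list (by
    change p.1.val.1 ++ q.1.val.1 = q.1.val.1
    rw [List.length_eq_zero_iff.mp p.1.val.2, List.nil_append])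
  change _ = diaValue a (Word.append (Nat.zero_add 1) p.1 q.1, q.2)
  rw [h]

theorem diaStr_str {𝒜 : Type u} (a : 𝒜) (Ξ : M 𝒜 1 (M 𝒜 0 Ω.{u})) :
    diaStr a (mapM 1 (truthStr 𝒜) Ξ) = diaStr a (mult rfl Ξ) := by
  refine congrArg ULift.up ?_
  rw [mapM_apply, mult_apply, expectation_map, expectation_bind]
  simp only [expectation_map]
  congr 1
  funext p
  have h : ∀ w : Word 𝒜 0, Word.append (Nat.add_zero 1) p.1 w = p.1 := fun w =>
    Word.ext_list (by
      change p.1.val.1 ++ w.val.1 = p.1.val.1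
      rw [List.length_eq_zero_iff.mp w.val.2, List.append_nil])
  have h' : (fun q : Word 𝒜 0 × Ω.{u} =>
      diaValue a (Word.append (Nat.add_zero 1) p.1 q.1, q.2)) =
        fun q => diaValue a (p.1, q.2) := by
    funext q
    rw [h]
  refine Eq.trans ?_ (congrArg (fun v => expectation v p.2) h').symm
  unfold diaValue
  dsimp only
  split_ifs
  · rfl
  · exact (expectation_zero _).symm

/-- `[0,1]` as an `M₀`-algebra. -/
noncomputable def truthAlg (𝒜 : Type u) : M0Algebra 𝒜 where
  carrier := Ω.{u}
  str := truthStr 𝒜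
  str_unit _ := congrArg ULift.up (expectation_pure _ _)
  str_mult := truthStr_mult 𝒜

/-- The `M₁`-algebra on `[0,1]` that interprets the modality `⟨a⟩`. -/
noncomputable def diaAlg {𝒜 : Type u} (a : 𝒜) : M1Algebra 𝒜 where
  part₀ := truthAlg 𝒜
  part₁ := truthAlg 𝒜
  main := diaStr a
  main_mult := diaStr_mult a
  main_str := diaStr_str a

/-- `⟦⟨a⟩⟧(f) : A₁ → Ω` for a canonical `M₁`-algebra `A` and an `M₀`-morphism `f : A₀ → Ω`: the
unique `M₀`-morphism that extends `f` to a morphism of `M₁`-algebras to `diaAlg a`. -/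
noncomputable def modal {𝒜 : Type u} (a : 𝒜) {A : M1Algebra 𝒜} (hA : A.IsCanonical)
    (f : M0Hom A.part₀ (truthAlg 𝒜)) : M0Hom A.part₁ (truthAlg 𝒜) :=
  (hA (diaAlg a) f).choose.hom₁

/-- The characterization of `⟦⟨a⟩⟧(f)` by its commutative square. -/
theorem modal_main {𝒜 : Type u} (a : 𝒜) {A : M1Algebra 𝒜} (hA : A.IsCanonical)
    (f : M0Hom A.part₀ (truthAlg 𝒜)) (ξ : M 𝒜 1 A.part₀) :
    (modal a hA f).toMap (A.main ξ) = (diaAlg a).main (mapM 1 f.toMap ξ) := by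
  have h1 := (hA (diaAlg a) f).choose.map_main ξ
  have h2 : (hA (diaAlg a) f).choose.hom₀ = f := (hA (diaAlg a) f).choose_spec.1
  rw [h2] at h1
  exact h1

/-! ### The logic: syntax and semantics -/

/-- Formulae of uniform depth `n`: there is one truth constant `⊤`, one unary modality `⟨a⟩` for
each `a : 𝒜`, and no propositional operator. -/
inductive Formula (𝒜 : Type u) : ℕ → Type u
  | top : Formula 𝒜 0
  | dia {n : ℕ} (a : 𝒜) (φ : Formula 𝒜 n) : Formula 𝒜 (n + 1)

/-- The interpretation `1 → Ω` of the truth constant `⊤`, with value `1`. -/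
def topValue : PUnit.{u + 1} →o Ω.{u} where
  toFun _ := ULift.up 1
  monotone' _ _ _ := le_rfl

theorem evalTop_aux (𝒜 : Type u) (ξ : M 𝒜 0 (M 𝒜 0 PUnit.{u + 1})) :
    truthStr 𝒜 (mapM 0 topValue (mult (Nat.zero_add 0) ξ)) =
      truthStr 𝒜 (mapM 0 ((truthStr 𝒜).comp (mapM 0 topValue)) ξ) := by
  rw [← mult_mapM, ← truthStr_mult, mapM_mapM]

/-- `⟦⊤⟧ : M₀ 1 → M₀ Ω → Ω`. -/
noncomputable def evalTop (𝒜 : Type u) :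
    M0Hom (freeAlg 𝒜 0 PUnit.{u + 1}) (truthAlg 𝒜) where
  toMap := (truthStr 𝒜).comp (mapM 0 topValue)
  map_str := evalTop_aux 𝒜

/-- The evaluation `⟦φ⟧ : M n 1 → Ω` of a formula `φ` of uniform depth `n`. -/
noncomputable def Formula.eval {𝒜 : Type u} :
    {n : ℕ} → Formula 𝒜 n → M0Hom (freeAlg 𝒜 n PUnit.{u + 1}) (truthAlg 𝒜)
  | _, .top => evalTop 𝒜
  | _, .dia (n := n) a φ => modal a (freeAlg₁_isCanonical 𝒜 n PUnit.{u + 1}) φ.eval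

/-! ### Probabilistic transition systems and probabilistic trace inclusion -/

/-- Ordered probabilistic transition systems: coalgebras for `𝒮(𝒜 × -)`. -/
abbrev Coalg (𝒜 : Type u) (X : Type u) [PartialOrder X] : Type u :=
  X →o SubDist (Disc 𝒜 × X)

section Behaviour

variable {𝒜 : Type u} {X Y : Type u} [PartialOrder X] [PartialOrder Y]

/-- The identification `𝒮(𝒜 × X) → M 1 X` of letters with words of length one. -/
noncomputable def toM1 : SubDist (Disc 𝒜 × X) →o M 𝒜 1 X where
  toFun := SubDist.map fun p => (Word.letter p.1.val, p.2)
  monotone' := SubDist.map_mono fun p q h => by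
    obtain ⟨a, x⟩ := p
    obtain ⟨b, y⟩ := q
    obtain ⟨h1, h2⟩ := h
    change a = b at h1
    subst h1
    exact ⟨le_rfl, h2⟩

/-- The `n`-step behaviour `γ⁽ⁿ⁾ : X → M n X`. -/
noncomputable def behaviour (γ : Coalg 𝒜 X) : (n : ℕ) → X →o M 𝒜 n X
  | 0 => unitM
  | n + 1 => (mult (Nat.add_comm 1 n)).comp ((mapM 1 (behaviour γ n)).comp (toM1.comp γ))

/-- The map `M n ! ∘ γ⁽ⁿ⁾ : X → M n 1`: the subdistribution on traces of length `n`. -/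
noncomputable def traces (γ : Coalg 𝒜 X) (n : ℕ) : X →o M 𝒜 n PUnit.{u + 1} :=
  (mapM n ⟨fun _ => PUnit.unit, fun _ _ _ => le_rfl⟩).comp (behaviour γ n)

/-- Probabilistic trace inclusion: `y` refines `x`. -/
def Refines (γ : Coalg 𝒜 X) (δ : Coalg 𝒜 Y) (x : X) (y : Y) : Prop :=
  ∀ n, traces γ n x ≤ traces δ n y

/-- The meaning `⟦φ⟧_γ : X → Ω` of a formula in a coalgebra. -/
noncomputable def Formula.meaning {n : ℕ} (φ : Formula 𝒜 n) (γ : Coalg 𝒜 X) : X →o Ω.{u} :=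
  φ.eval.toMap.comp (traces γ n)

end Behaviour

/-! ### Separation and expressiveness -/

/-- A set of monotone maps is jointly order-reflecting. -/
def JointlyOrderReflecting {X Y : Type u} [PartialOrder X] [PartialOrder Y]
    (S : Set (X →o Y)) : Prop :=
  ∀ x y : X, (∀ f ∈ S, f x ≤ f y) → x ≤ y

/-- The logic is depth-1 separating: for each canonical `M₁`-algebra `A` and each jointly
order-reflecting set `F` of `M₀`-morphisms `A₀ → Ω`, the set of all `⟦⟨a⟩⟧(f) : A₁ → Ω` with
`a : 𝒜` and `f ∈ F` is jointly order-reflecting. (Closure of `F` under propositional operators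
is no condition, as there are none.) -/
def IsDepthOneSeparating (𝒜 : Type u) : Prop :=
  ∀ (A : M1Algebra 𝒜) (hA : A.IsCanonical) (F : Set (M0Hom A.part₀ (truthAlg 𝒜))),
    JointlyOrderReflecting {g | ∃ f ∈ F, g = f.toMap} →
      JointlyOrderReflecting {g | ∃ a : 𝒜, ∃ f ∈ F, g = (modal a hA f).toMap}

/-- The logic is expressive for probabilistic trace inclusion: theory inclusion implies
refinement. -/
def IsExpressive (𝒜 : Type u) : Prop :=
  ∀ (X Y : Type u) [PartialOrder X] [PartialOrder Y] (γ : Coalg 𝒜 X) (δ : Coalg 𝒜 Y)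
    (x : X) (y : Y),
    (∀ (n : ℕ) (φ : Formula 𝒜 n), φ.meaning γ x ≤ φ.meaning δ y) → Refines γ δ x y

end ProbTrace

/-! Write an element of `A₁` as `∑ a, p a • a(x a)`, with a subdistribution `p` on letters and one
argument `x a` in `A₀` for each letter. This normal form is always available. The map `A.main` is
surjective, because canonicity makes the identity of `A` factor through the range of `A.main`
(`M1Algebra.IsCanonical.main_surjective`). Disintegrating a preimage along its letters then leaves a
subdistribution on `A₀` over each letter, which `A₀` evaluates to a single point
(`M1Algebra.exists_combine`).

On normal forms the modality `⟨a⟩` takes the value `p a * f (x a)` (`value_modal_combine`). The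
hypothesis on two elements thus becomes `p a * f (x a) ≤ q a * f (y a)` for all letters `a` and all
`f` in the set. Morphisms `f` are homogeneous (`M0Hom.value_scaledPure`) and jointly
order-reflecting, so the quotient of the two weights can be moved inside `f`. If `q a < p a`, then
`x a ≤ (q a / p a) • y a` in `A₀`; otherwise `(p a / q a) • x a ≤ y a` when `q a` is nonzero. Since
`p a • a(r • z) = (p a * r) • a(z)` for `r ≤ 1` (`M1Algebra.combine_scale`), both cases pass through
a common intermediate element with weights `min (p a) (q a)`, and monotonicity of `A.main`
concludes.

Expressiveness follows by induction on the depth: `⊤` determines the order of `M 0 1`, and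
separation, applied to the canonical algebra `(M n 1, M (n+1) 1)`, carries order reflection from
depth `n` to depth `n + 1`. -/

namespace ProbTrace

universe v

/-! ### Comparison, scaling and disintegration of subdistributions -/

section SubDist

variable {X Y : Type v}

theorem mapDomain_mono (f : X → Y) {v w : X →₀ ℝ≥0} (h : v ≤ w) :
    v.mapDomain f ≤ w.mapDomain f := by
  obtain ⟨z, rfl⟩ := exists_add_of_le h
  rw [Finsupp.mapDomain_add]
  exact le_add_of_nonneg_right zero_le

theorem SubDist.le_of_weight_le [PartialOrder X] {μ ν : SubDist X} (h : μ.weight ≤ ν.weight) :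
    μ ≤ ν := by
  obtain ⟨ω, h₁, h₂, h₃⟩ := Coupled.refl μ.weight
  exact SubDist.le_iff.mpr ⟨ω, h₁, h₂, h₃.trans h⟩

/-- The image subdistribution is monotone in the map, compared on the support only. -/
theorem SubDist.map_le_map [PartialOrder Y] (μ : SubDist X) {f g : X → Y}
    (h : ∀ x, μ.weight x ≠ 0 → f x ≤ g x) : μ.map f ≤ μ.map g := by
  classical
  refine SubDist.le_iff.mpr ⟨μ.weight.mapDomain fun x => (f x, g x), ?_, ?_, ?_⟩
  · intro p hp
    obtain ⟨x, hx, rfl⟩ := Finset.mem_image.mp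
      (Finsupp.mapDomain_support (Finsupp.mem_support_iff.mpr hp))
    exact h x (Finsupp.mem_support_iff.mp hx)
  · rw [← Finsupp.mapDomain_comp]; rfl
  · rw [← Finsupp.mapDomain_comp]; exact le_rfl

/-- The pointwise minimum of two subdistributions. -/
noncomputable def SubDist.inf (μ ν : SubDist X) : SubDist X where
  weight := μ.weight ⊓ ν.weight
  total_le_one := by
    rw [← mass_eq]; exact (mass_mono inf_le_left).trans μ.mass_le

/-- The subdistribution `min r 1 • x`. -/
noncomputable def SubDist.scaledPure (r : ℝ≥0) (x : X) : SubDist X where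
  weight := Finsupp.single x (min r 1)
  total_le_one := by rw [← mass_eq, mass_single]; exact min_le_right _ _

/-- Disintegration of a subdistribution on a product along its first marginal. -/
theorem SubDist.exists_disintegration (ξ : SubDist (X × Y)) :
    ∃ k : X → SubDist Y,
      ξ = (ξ.map Prod.fst).bind fun x => (k x).map fun y => (x, y) := by
  classical
  set p := ξ.weight.mapDomain Prod.fst with hp
  let c : X → (Y →₀ ℝ≥0) := fun x => ξ.weight.curry x
  have hc : ∀ x, (c x).mapDomain (fun y => (x, y)) ≤ ξ.weight := by
    rintro x ⟨x', y⟩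
    by_cases h : x = x'
    · subst h
      rw [Finsupp.mapDomain_apply (f := fun y : Y => (x, y)) (fun _ _ h => (Prod.ext_iff.mp h).2)]
      exact le_rfl
    · rw [Finsupp.mapDomain_of_notMem_range]
      · exact zero_le
      · rintro ⟨z, hz⟩
        exact h (Prod.ext_iff.mp hz).1
  -- The slice `c x`, placed over `x`, lies below `ξ`; comparing first marginals at `x` bounds its
  -- mass.
  have hm : ∀ x, mass Y (c x) ≤ p x := by
    intro x
    have h := mapDomain_mono Prod.fst (hc x) x
    rw [← Finsupp.mapDomain_comp] at h
    have e : (Prod.fst ∘ fun y : Y => (x, y)) = fun _ => x := rfl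
    rw [e, mapDomain_const, Finsupp.single_eq_same] at h
    exact h
  -- The conditional subdistribution over `x`. Where `p x = 0` the inverse is `0` and the kernel is
  -- the zero subdistribution, which is harmless since `ξ` then has no weight over `x`.
  refine ⟨fun x => ⟨(p x)⁻¹ • c x, ?_⟩, SubDist.ext (Finsupp.ext ?_)⟩
  · rw [← mass_eq, map_smul, smul_eq_mul]
    exact (mul_le_mul_right (hm x) _).trans (inv_mul_le_one)
  · rintro ⟨x, y⟩
    change ξ.weight (x, y) = Finsupp.linearCombination ℝ≥0
      (fun z => ((p z)⁻¹ • c z).mapDomain fun y => (z, y)) p (x, y)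
    rw [Finsupp.linearCombination_apply, Finsupp.sum, Finsupp.finsetSum_apply,
      Finset.sum_eq_single x]
    · rw [Finsupp.smul_apply, Finsupp.mapDomain_apply (f := fun y : Y => (x, y))
        (fun _ _ h => (Prod.ext_iff.mp h).2), Finsupp.smul_apply, smul_smul]
      by_cases h : p x = 0
      · have h1 := le_mapDomain Prod.fst ξ.weight (x, y)
        rw [← hp] at h1
        rw [h, zero_mul, zero_smul]
        exact le_antisymm (h1.trans h.le) zero_le
      · rw [mul_inv_cancel₀ h, one_smul]
        rfl
    · intro z _ hz
      have h0 : ((p z)⁻¹ • c z).mapDomain (fun y => (z, y)) (x, y) = 0 := by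
        refine Finsupp.mapDomain_of_notMem_range _ _ ?_
        rintro ⟨w, hw⟩
        exact hz (Prod.ext_iff.mp hw).1
      rw [Finsupp.smul_apply, h0, smul_zero]
    · intro h
      rw [Finsupp.notMem_support_iff.mp h, zero_smul, Finsupp.zero_apply]

end SubDist

theorem Word.eq_nil {𝒜 : Type v} (w : Word 𝒜 0) : w = Word.nil :=
  Word.ext_list (List.length_eq_zero_iff.mp w.val.2)

theorem Word.append_nil {𝒜 : Type v} {n : ℕ} (w : Word 𝒜 n) :
    Word.append (Nat.add_zero n) w Word.nil = w :=
  Word.ext_list (List.append_nil _)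

/-! ### Elements of canonical algebras -/

section Canonical

variable {𝒜 : Type v} (A : M1Algebra 𝒜)

/-- The law `main_mult` turns a combination of values of `A.main` into `A.main` of the combination
of preimages, so the range is a subalgebra. -/
theorem M1Algebra.str_mem_range_main (ξ : M 𝒜 0 (Set.range A.main)) :
    A.part₁.str (SubDist.map (fun p => (p.1, p.2.1)) ξ) ∈ Set.range A.main := by
  -- The choice of preimages need not be monotone, hence `SubDist.map`, which accepts any function,
  -- in place of `mapM`.
  choose s hs using fun b : Set.range A.main => b.2
  refine ⟨mult rfl (SubDist.map (fun p => (p.1, s p.2)) ξ), ?_⟩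
  rw [← A.main_mult, mapM_apply, SubDist.map_map]
  simp only [Function.comp_def, hs]

/-- The inclusion of the range of the main structure map. -/
def M1Algebra.rangeIncl : Set.range A.main →o A.part₁ := ⟨Subtype.val, fun _ _ h => h⟩

/-- The main structure map, corestricted to its range. -/
def M1Algebra.mainRange : M 𝒜 1 A.part₀ →o Set.range A.main :=
  ⟨fun ξ => ⟨A.main ξ, Set.mem_range_self ξ⟩, fun _ _ h => A.main.monotone h⟩

/-- The range of the main structure map, as a subalgebra of the `1`-part. -/
noncomputable def M1Algebra.rangeAlg : M0Algebra 𝒜 where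
  carrier := Set.range A.main
  str := ⟨fun ξ => ⟨A.part₁.str (mapM 0 A.rangeIncl ξ), A.str_mem_range_main ξ⟩,
    fun _ _ h => A.part₁.str.monotone ((mapM 0 A.rangeIncl).monotone h)⟩
  str_unit x := Subtype.ext (by
    change A.part₁.str (mapM 0 A.rangeIncl (unitM x)) = _
    rw [mapM_unitM, A.part₁.str_unit]; rfl)
  str_mult Ξ := Subtype.ext (by
    change A.part₁.str (mapM 0 A.rangeIncl (mapM 0 _ Ξ)) =
      A.part₁.str (mapM 0 A.rangeIncl (mult rfl Ξ))
    rw [← mult_mapM, ← A.part₁.str_mult, mapM_mapM, mapM_mapM]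
    rfl)

/-- The algebra `A` with its `1`-part restricted to the range of the main structure map. -/
noncomputable def M1Algebra.corestrict : M1Algebra 𝒜 where
  part₀ := A.part₀
  part₁ := A.rangeAlg
  main := A.mainRange
  main_mult Ξ := Subtype.ext <|
    (congrArg A.part₁.str (mapM_mapM A.mainRange A.rangeIncl Ξ)).trans (A.main_mult Ξ)
  main_str Ξ := Subtype.ext (A.main_str Ξ)

variable {A}

/-- The identity of `A₀` extends to a morphism from `A` into its corestriction. Followed by the
inclusion of the range, it is an endomorphism of `A` over the identity of `A₀`, hence the identity
by uniqueness. So the inclusion of the range is onto. -/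
theorem M1Algebra.IsCanonical.main_surjective (hA : A.IsCanonical) :
    Function.Surjective A.main := by
  let i : M0Hom A.part₀ A.part₀ := ⟨OrderHom.id, fun ξ => by rw [mapM_id]; rfl⟩
  obtain ⟨F, hF, -⟩ := hA A.corestrict i
  let G : M1Hom A A :=
    { hom₀ := i
      hom₁ := ⟨A.rangeIncl.comp F.hom₁.toMap, fun ξ =>
        (congrArg Subtype.val (F.hom₁.map_str ξ)).trans
          (congrArg A.part₁.str (mapM_mapM F.hom₁.toMap A.rangeIncl ξ))⟩
      map_main := fun ξ => by
        have h := congrArg Subtype.val (F.map_main ξ)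
        rw [hF] at h
        exact h }
  let I : M1Hom A A :=
    { hom₀ := i
      hom₁ := ⟨OrderHom.id, fun ξ => by rw [mapM_id]; rfl⟩
      map_main := fun ξ => by
        change A.main ξ = A.main (mapM 1 OrderHom.id ξ)
        rw [mapM_id] }
  have hGI : G = I := (hA A i).unique rfl rfl
  intro x
  have h : G.hom₁.toMap x = x := by rw [hGI]; rfl
  have h' := (F.hom₁.toMap x).2
  change (F.hom₁.toMap x).1 = x at h
  rwa [h] at h'

/-! ### Normal forms: one argument for each letter -/

variable (A)

/-- The element `∑ w, p w • (w, x w)` of `M 1 A₀`, evaluated in `A₁`. -/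
noncomputable def M1Algebra.combine (p : SubDist (Word 𝒜 1)) (x : Word 𝒜 1 → A.part₀) :
    A.part₁ :=
  A.main (p.map fun w => (w, x w))

/-- The subconvex combination in an `M₀`-algebra. -/
noncomputable def M0Algebra.eval (B : M0Algebra 𝒜) (μ : SubDist B) : B :=
  B.str (μ.map fun x => (Word.nil, x))

/-- This is the law `main_str` at a nested sum whose inner words are empty: evaluating the arguments
in `A₀` first amounts to flattening the sum. -/
theorem M1Algebra.combine_eval (p : SubDist (Word 𝒜 1)) (k : Word 𝒜 1 → SubDist A.part₀) :
    A.combine p (fun w => A.part₀.eval (k w)) =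
      A.main (p.bind fun w => (k w).map fun x => (w, x)) := by
  have h := A.main_str (p.map fun w => (w, (k w).map fun x => (Word.nil, x)))
  rw [mapM_apply, SubDist.map_map, mult_apply, SubDist.bind_map] at h
  simp only [SubDist.map_map, Function.comp_def, Word.append_nil] at h
  exact h

/-- Disintegrate `ξ` along its words and evaluate each conditional subdistribution to a point of
`A₀`. -/
theorem M1Algebra.exists_combine (ξ : M 𝒜 1 A.part₀) : ∃ p x, A.main ξ = A.combine p x := by
  obtain ⟨k, hk⟩ := ξ.exists_disintegration
  refine ⟨ξ.map Prod.fst, fun w => A.part₀.eval (k w), ?_⟩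
  rw [A.combine_eval, ← hk]

/-- Only words of nonzero weight need comparison; this is what permits division by the weights in
the separation argument. -/
theorem M1Algebra.combine_le_combine (p : SubDist (Word 𝒜 1)) {x y : Word 𝒜 1 → A.part₀}
    (h : ∀ w, p.weight w ≠ 0 → x w ≤ y w) : A.combine p x ≤ A.combine p y :=
  A.main.monotone (SubDist.map_le_map p fun w hw => ⟨le_rfl, h w hw⟩)

/-- Weights may be moved into the arguments. -/
theorem M1Algebra.combine_scale {m p : SubDist (Word 𝒜 1)} (h : m.weight ≤ p.weight)
    (x : Word 𝒜 1 → A.part₀) :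
    A.combine p (fun w =>
      A.part₀.eval (SubDist.scaledPure (m.weight w / p.weight w) (x w))) = A.combine m x := by
  classical
  rw [A.combine_eval]
  unfold M1Algebra.combine
  congr 1
  refine SubDist.ext ?_
  change Finsupp.linearCombination ℝ≥0 (fun w => (Finsupp.single (x w)
    (min (m.weight w / p.weight w) 1)).mapDomain fun x => (w, x)) p.weight =
      m.weight.mapDomain fun w => (w, x w)
  -- Lets both sums run over the support of `p`, where the quotient `m w / p w` is meaningful.
  have hs : m.weight.support ⊆ p.weight.support := fun w hw => by
    rw [Finsupp.mem_support_iff] at hw ⊢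
    exact fun h0 => hw (le_antisymm ((h w).trans h0.le) zero_le)
  rw [Finsupp.linearCombination_apply, Finsupp.mapDomain, Finsupp.sum,
    Finsupp.sum_of_support_subset _ hs _ (fun _ _ => Finsupp.single_zero _)]
  refine Finset.sum_congr rfl fun w hw => ?_
  -- The truncation at `1` in `SubDist.scaledPure` is inactive, since `m w ≤ p w`.
  rw [Finsupp.mapDomain_single, Finsupp.smul_single, smul_eq_mul,
    min_eq_left (div_le_one_of_le₀ (h w) zero_le),
    mul_div_cancel₀ _ (Finsupp.mem_support_iff.mp hw)]

end Canonical

/-! ### Separation -/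

section Separation

variable {𝒜 : Type v}

/-- The real number underlying the value of an `M₀`-morphism to `Ω`. -/
noncomputable def M0Hom.value {B : M0Algebra 𝒜} (f : M0Hom B (truthAlg 𝒜)) (x : B) : ℝ≥0 :=
  unitInterval.toNNReal (ULift.down (f.toMap x))

theorem M0Hom.value_le_iff {B : M0Algebra 𝒜} (f : M0Hom B (truthAlg 𝒜)) (x y : B) :
    f.value x ≤ f.value y ↔ f.toMap x ≤ f.toMap y := Iff.rfl

/-- Morphisms preserve subconvex combinations, and in `Ω` these are expected values; a sum with one
summand gives a product. -/
theorem M0Hom.value_scaledPure {B : M0Algebra 𝒜} (f : M0Hom B (truthAlg 𝒜)) (r : ℝ≥0) (x : B) :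
    f.value (B.eval (SubDist.scaledPure r x)) = min r 1 * f.value x := by
  refine NNReal.coe_injective ?_
  change ((ULift.down (f.toMap (B.str _)) : unitInterval) : ℝ) = _
  rw [f.map_str, mapM_apply, SubDist.map_map]
  refine (congrArg Subtype.val (expectation_map _ _ _)).trans ?_
  rw [expectation_eq]
  change Finsupp.linearCombination ℝ≥0 _ (Finsupp.single _ _) = _
  rw [Finsupp.linearCombination_single]
  rfl

/-- By the defining square of the modality the value is an expectation of `diaValue a`, which
vanishes off the letter `a`; a normal form has a single argument over that letter. -/
theorem value_modal_combine {A : M1Algebra 𝒜} (hA : A.IsCanonical) (a : 𝒜)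
    (f : M0Hom A.part₀ (truthAlg 𝒜)) (p : SubDist (Word 𝒜 1)) (x : Word 𝒜 1 → A.part₀) :
    (modal a hA f).value (A.combine p x) =
      p.weight (Word.letter a) * f.value (x (Word.letter a)) := by
  classical
  refine NNReal.coe_injective ?_
  change ((ULift.down ((modal a hA f).toMap (A.main _)) : unitInterval) : ℝ) = _
  rw [modal_main, mapM_apply, SubDist.map_map]
  refine (congrArg Subtype.val (expectation_map _ _ _)).trans ?_
  rw [expectation_eq, Finsupp.linearCombination_apply, Finsupp.sum,
    Finset.sum_eq_single (Word.letter a)]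
  · simp only [diaValue, Function.comp_apply, if_true]
    rfl
  · intro w _ hw
    simp only [diaValue, Function.comp_apply, if_neg hw]
    exact smul_zero _
  · intro h
    rw [Finsupp.notMem_support_iff.mp h, zero_smul]

theorem isDepthOneSeparating (𝒜 : Type v) : IsDepthOneSeparating 𝒜 := by
  classical
  intro A hA F hF x y hxy
  obtain ⟨ξ, rfl⟩ := hA.main_surjective x
  obtain ⟨ζ, rfl⟩ := hA.main_surjective y
  obtain ⟨p, x, hx⟩ := A.exists_combine ξ
  obtain ⟨q, y, hy⟩ := A.exists_combine ζ
  rw [hx, hy] at hxy ⊢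
  have hle : ∀ f ∈ F, ∀ w, p.weight w * f.value (x w) ≤ q.weight w * f.value (y w) := by
    intro f hf w
    -- Each word of length one is a letter, so the modalities see all of them.
    rw [← Word.letter_head w, ← value_modal_combine hA, ← value_modal_combine hA]
    exact hxy _ ⟨w.val.head, f, hf, rfl⟩
  have reflect : ∀ b c : A.part₀, (∀ f ∈ F, f.value b ≤ f.value c) → b ≤ c := by
    intro b c h
    refine hF b c ?_
    rintro _ ⟨f, hf, rfl⟩
    exact h f hf
  let m := p.inf q
  have hmw : ∀ w, m.weight w = min (p.weight w) (q.weight w) := fun w => rfl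
  -- The intermediate element has weights `min p q`; over each word it keeps the argument that
  -- belongs to the smaller weight.
  let u : Word 𝒜 1 → A.part₀ := fun w => if q.weight w < p.weight w then y w else x w
  calc A.combine p x
      ≤ A.combine p (fun w =>
          A.part₀.eval (SubDist.scaledPure (m.weight w / p.weight w) (u w))) := by
        refine A.combine_le_combine p fun w hw => reflect _ _ fun f hf => ?_
        rw [M0Hom.value_scaledPure, hmw]
        -- If `q w < p w`, the claim `f (x w) ≤ (q w / p w) * f (y w)` is the hypothesis divided by
        -- `p w`. Otherwise the factor is `1` and both arguments are `x w`.
        by_cases h : q.weight w < p.weight w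
        · simp only [u, if_pos h]
          rw [min_eq_right h.le, min_eq_left (div_le_one_of_le₀ h.le zero_le), div_mul_eq_mul_div,
            le_div_iff₀ (pos_iff_ne_zero.mpr hw), mul_comm]
          exact hle f hf w
        · simp only [u, if_neg h]
          rw [min_eq_left (not_lt.mp h), div_self hw, min_self, one_mul]
    _ = A.combine m u := A.combine_scale inf_le_left u
    _ = A.combine q (fun w =>
          A.part₀.eval (SubDist.scaledPure (m.weight w / q.weight w) (u w))) :=
        (A.combine_scale inf_le_right u).symm
    _ ≤ A.combine q y := by
        refine A.combine_le_combine q fun w hw => reflect _ _ fun f hf => ?_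
        rw [M0Hom.value_scaledPure, hmw]
        -- The mirror image: for `q w < p w` both sides are `y w` with factor `1`; otherwise the
        -- hypothesis is divided by `q w`.
        by_cases h : q.weight w < p.weight w
        · simp only [u, if_pos h]
          rw [min_eq_right h.le, div_self hw, min_self, one_mul]
        · simp only [u, if_neg h]
          rw [min_eq_left (not_lt.mp h),
            min_eq_left (div_le_one_of_le₀ (not_lt.mp h) zero_le), div_mul_eq_mul_div,
            div_le_iff₀ (pos_iff_ne_zero.mpr hw), mul_comm _ (q.weight w)]
          exact hle f hf w

/-! ### Expressiveness by induction on the depth -/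

/-- An element of `M 0 1` lives on a single point, so it amounts to one weight, and `⊤` reads it
off. -/
theorem value_evalTop (ξ : M 𝒜 0 PUnit.{v + 1}) :
    (evalTop 𝒜).value ξ = ξ.weight (Word.nil, PUnit.unit) := by
  have hξ : ξ.weight = Finsupp.single (Word.nil, PUnit.unit) (ξ.weight (Word.nil, PUnit.unit)) := by
    ext ⟨w, _⟩
    rw [Word.eq_nil w, Finsupp.single_eq_same]
  refine NNReal.coe_injective ?_
  change (expectation _ (SubDist.map _ ξ) : ℝ) = _
  rw [expectation_map, expectation_eq, hξ, Finsupp.linearCombination_single,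
    Finsupp.single_eq_same]
  exact mul_one _

/-- Induction on `n`: at depth `0` the weight read by `⊤` decides the order, and the successor step
is separation for `freeAlg₁`, where `modal a` applied to `φ.eval` is by definition the evaluation of
`⟨a⟩φ`. -/
theorem jointlyOrderReflecting_eval (𝒜 : Type v) (n : ℕ) :
    JointlyOrderReflecting {g | ∃ φ : Formula 𝒜 n, g = φ.eval.toMap} := by
  induction n with
  | zero =>
    intro ξ ζ h
    refine SubDist.le_of_weight_le ?_
    rintro ⟨w, _⟩
    rw [Word.eq_nil w]
    have h1 := ((evalTop 𝒜).value_le_iff ξ ζ).mpr (h _ ⟨Formula.top, rfl⟩)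
    exact ((value_evalTop ξ).symm.le.trans h1).trans (value_evalTop ζ).le
  | succ n ih =>
    intro ξ ζ h
    refine isDepthOneSeparating 𝒜 (freeAlg₁ 𝒜 n PUnit.{v + 1}) (freeAlg₁_isCanonical 𝒜 n _)
      {f | ∃ φ : Formula 𝒜 n, f = φ.eval} ?_ ξ ζ ?_
    · intro b c hbc
      refine ih b c ?_
      rintro _ ⟨φ, rfl⟩
      exact hbc _ ⟨_, ⟨φ, rfl⟩, rfl⟩
    · rintro _ ⟨a, _, ⟨φ, rfl⟩, rfl⟩
      exact h _ ⟨Formula.dia a φ, rfl⟩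

/-- The meaning of a formula factors through the trace subdistribution in `M n 1`, so theory
inclusion is already a comparison of evaluations there. -/
theorem isExpressive (𝒜 : Type v) : IsExpressive 𝒜 := by
  intro X Y _ _ γ δ x y h n
  refine jointlyOrderReflecting_eval 𝒜 n _ _ ?_
  rintro _ ⟨φ, rfl⟩
  exact h n φ

end Separation

end ProbTrace

theorem mainTheorem6 (𝒜 : Type*) :
    ProbTrace.IsDepthOneSeparating 𝒜 ∧ ProbTrace.IsExpressive 𝒜 :=
  ⟨ProbTrace.isDepthOneSeparating 𝒜, ProbTrace.isExpressive 𝒜⟩
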